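/- Let $1\le k\le n$ be integers, let $e_1,\dots,e_n\in\mathbb{R}[X_1,\dots,X_n]$ be the elementary symmetric polynomials, and let $l_1,\dots,l_k\in\mathbb{R}[Z_1,\dots,Z_n]$ be linearly independent linear forms (homogeneous polynomials of degree $1$). A symmetric polynomial $f\in\mathbb{R}[X_1,\dots,X_n]$ is called \emph{$(l_1,\dots,l_k)$-sufficient} if $f=g(e_1,\dots,e_n)$ for some $g$ in the subalgebra $\mathbb{R}[l_1,\dots,l_k]\subseteq\mathbb{R}[Z_1,\dots,Z_n]$. For $m\in\mathbb{N}$ let $\mathcal{A}_m=\{x\in\mathbb{R}^n : |\{x_1,\dots,x_n\}|\le m\}$ be the set of points with at most $m$ distinct coordinates; $f$ is called \emph{$m$-complete} if $f(\mathbb{R}^n)=f(\mathcal{A}_m)$. Let $f\in\mathbb{R}[X_1,\dots,X_n]$ be an $(l_1,\dots,l_k)$-sufficient symmetric polynomial. Then 1. $f$ is $(k+1)$-complete; 2. if $Z_1\in\operatorname{span}_{\mathbb{R}}(l_1,\dots,l_k)$, then $f$ is $k$-complete. -/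

import Mathlib

namespace HyperbolicSlices

/-- `f = g(e₁, …, eₙ)` for some `g` in the subalgebra `ℝ[l₁, …, l_k]` of `ℝ[Z₁, …, Zₙ]`.
The variable `Z_{i+1}` is `X i` for `i : Fin n`, and it is replaced by `e_{i+1}`. -/
def IsSufficient {n k : ℕ} (l : Fin k → MvPolynomial (Fin n) ℝ)
    (f : MvPolynomial (Fin n) ℝ) : Prop :=
  ∃ g ∈ Algebra.adjoin ℝ (Set.range l),
    f = MvPolynomial.aeval (fun i : Fin n => MvPolynomial.esymm (Fin n) ℝ ((i : ℕ) + 1)) g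

/-- The set `𝒜_m` of points of `ℝⁿ` with at most `m` distinct coordinates. -/
def fewCoords (n m : ℕ) : Set (Fin n → ℝ) :=
  {x | (Set.range x).ncard ≤ m}

/-- `f(ℝⁿ) = f(𝒜_m)`. -/
def IsValueComplete {n : ℕ} (m : ℕ) (f : MvPolynomial (Fin n) ℝ) : Prop :=
  (fun x : Fin n → ℝ => MvPolynomial.eval x f) '' Set.univ =
    (fun x : Fin n → ℝ => MvPolynomial.eval x f) '' fewCoords n m

end HyperbolicSlices

/-! By sufficiency, f depends only on k linear conditions on (e₁, …, eₙ), so it is enough to find a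
point with few distinct coordinates in each fibre of such conditions. If e₁ is fixed, ∑ yᵢ² = e₁² -
2e₂ is affine in the e-values, and its sublevel sets are compact. Minimise it on the fibre, then
maximise the strictly convex ∑ eᵢ² over the minimisers. A maximiser with more than k distinct
coordinates would be the midpoint, in e-space, of two other points of the fibre
(`exists_opposite_perturbations`), which is impossible. In part 1, e₁ is imposed as an extra
condition. -/

open Polynomial in
/-- A small perturbation of a product of distinct real linear factors by a polynomial of smaller
degree is again a product of real linear factors. -/
theorem exists_prod_X_sub_C_add_smul (s : Finset ℝ) (S : ℝ[X]) (hS : S.degree < s.card) :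
    ∀ᶠ t : ℝ in nhds 0, ∃ b : ℝ → ℝ,
      ∏ a ∈ s, (X - C a) + t • S = ∏ a ∈ s, (X - C (b a)) := by
  obtain ⟨δ, hδ, hgap⟩ : ∃ δ > 0, ∀ a ∈ s, ∀ b ∈ s, a ≠ b → 2 * δ ≤ |a - b| := by
    have h : ∀ᶠ δ : ℝ in nhdsWithin 0 (Set.Ioi 0),
        ∀ a ∈ s, ∀ b ∈ s, a ≠ b → 2 * δ ≤ |a - b| := by
      rw [Filter.eventually_all_finset]
      intro a _
      rw [Filter.eventually_all_finset]
      intro b _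
      by_cases hab : a = b
      · exact Filter.Eventually.of_forall fun _ h => absurd hab h
      have hpos : 0 < |a - b| / 2 := half_pos (abs_pos.2 (sub_ne_zero.2 hab))
      filter_upwards [nhdsWithin_le_nhds (Iio_mem_nhds hpos)] with δ hδ _
      have : δ < |a - b| / 2 := hδ
      linarith
    obtain ⟨δ, h1, h2⟩ := (h.and self_mem_nhdsWithin).exists
    exact ⟨δ, h2, h1⟩
  -- The factor b = a contributes -δ², every other one (a - b)² - δ² > 0.
  have hsign : ∀ a ∈ s, (∏ b ∈ s, (X - C b) : ℝ[X]).eval (a - δ) *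
      (∏ b ∈ s, (X - C b) : ℝ[X]).eval (a + δ) < 0 := by
    intro a ha
    rw [eval_prod, eval_prod, ← Finset.prod_mul_distrib, ← Finset.mul_prod_erase s _ ha]
    apply mul_neg_of_neg_of_pos
    · simp only [eval_sub, eval_X, eval_C]
      nlinarith
    · refine Finset.prod_pos fun b hb => ?_
      have h1 := hgap a ha b (Finset.mem_of_mem_erase hb) (Finset.ne_of_mem_erase hb).symm
      have h2 : δ ^ 2 < |a - b| ^ 2 := by
        apply pow_lt_pow_left₀ _ hδ.le two_ne_zero
        linarith
      rw [sq_abs] at h2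
      simp only [eval_sub, eval_X, eval_C]
      nlinarith
  have hev : ∀ᶠ t : ℝ in nhds 0, ∀ a ∈ s,
      (∏ b ∈ s, (X - C b) + t • S : ℝ[X]).eval (a - δ) *
        (∏ b ∈ s, (X - C b) + t • S : ℝ[X]).eval (a + δ) < 0 := by
    rw [Filter.eventually_all_finset]
    intro a ha
    have hc : Continuous fun t : ℝ => (∏ b ∈ s, (X - C b) + t • S : ℝ[X]).eval (a - δ) *
        (∏ b ∈ s, (X - C b) + t • S : ℝ[X]).eval (a + δ) := by
      simp only [eval_add, eval_smul, smul_eq_mul]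
      fun_prop
    refine hc.continuousAt.eventually_lt continuousAt_const ?_
    simpa using hsign a ha
  filter_upwards [hev] with t ht
  set p : ℝ[X] := ∏ b ∈ s, (X - C b) + t • S with hp
  have hroot : ∀ a ∈ s, ∃ b, |b - a| < δ ∧ p.eval b = 0 := by
    intro a ha
    have hle : a - δ ≤ a + δ := by linarith
    have hcont : ContinuousOn (fun x => p.eval x) (Set.Icc (a - δ) (a + δ)) :=
      p.continuous.continuousOn
    rcases mul_neg_iff.1 (ht a ha) with ⟨h1, h2⟩ | ⟨h1, h2⟩
    · obtain ⟨b, hb, hb0⟩ := intermediate_value_Ioo' hle hcont ⟨h2, h1⟩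
      exact ⟨b, abs_lt.2 ⟨by linarith [hb.1], by linarith [hb.2]⟩, hb0⟩
    · obtain ⟨b, hb, hb0⟩ := intermediate_value_Ioo hle hcont ⟨h1, h2⟩
      exact ⟨b, abs_lt.2 ⟨by linarith [hb.1], by linarith [hb.2]⟩, hb0⟩
  choose! b hb hb0 using hroot
  -- The δ-intervals around the old roots are disjoint, so the new roots are distinct and exhaust
  -- the degree.
  have hinj : Set.InjOn b s := by
    intro a ha a' ha' h
    by_contra hne
    have h1 := hgap a ha a' ha' hne
    have h2 := hb a ha
    have h3 := hb a' ha'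
    rw [h, abs_sub_comm] at h2
    have h4 := abs_sub_le a (b a') a'
    linarith
  have hmonic : (∏ b ∈ s, (X - C b) : ℝ[X]).Monic :=
    monic_prod_of_monic _ _ fun a _ => monic_X_sub_C a
  have hdeg : (∏ b ∈ s, (X - C b) : ℝ[X]).degree = s.card := by
    rw [degree_prod]
    simp
  have hlt : (t • S).degree < (∏ b ∈ s, (X - C b) : ℝ[X]).degree :=
    hdeg ▸ (degree_smul_le t S).trans_lt hS
  have hpm : p.Monic := hmonic.add_of_left hlt
  have hpd : p.degree = s.card := by rw [hp, degree_add_eq_left_of_degree_lt hlt, hdeg]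
  refine ⟨b, ?_⟩
  have hdvd : ∏ a ∈ s, (X - C (b a)) ∣ p := by
    refine Finset.prod_dvd_of_coprime ?_ fun a ha => dvd_iff_isRoot.2 (hb0 a ha)
    intro a ha a' ha' hne
    exact isCoprime_X_sub_C_of_isUnit_sub (sub_ne_zero.2 (hinj.ne ha ha' hne)).isUnit
  have hqm : (∏ a ∈ s, (X - C (b a)) : ℝ[X]).Monic :=
    monic_prod_of_monic _ _ fun a _ => monic_X_sub_C _
  refine (eq_of_monic_of_dvd_of_natDegree_le hqm hpm hdvd ?_)
  rw [natDegree_eq_of_degree_eq_some hpd, natDegree_prod_of_monic _ _ fun a _ => monic_X_sub_C _]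
  simp

namespace HyperbolicSlices

/-- The values `(e₁(y), …, eₙ(y))` of the elementary symmetric polynomials. -/
noncomputable def esymmValues {n : ℕ} (y : Fin n → ℝ) : Fin n → ℝ :=
  fun i => MvPolynomial.eval y (MvPolynomial.esymm (Fin n) ℝ ((i : ℕ) + 1))

theorem continuous_esymmValues {n : ℕ} : Continuous (esymmValues (n := n)) :=
  continuous_pi fun _ => MvPolynomial.continuous_eval _

open Polynomial in
/-- The signed coefficients of a polynomial, in the order that turns `∏ (X - yᵢ)` into
`(e₁(y), …, eₙ(y))`. -/
noncomputable def signedCoeffs (n : ℕ) : ℝ[X] →ₗ[ℝ] (Fin n → ℝ) :=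
  LinearMap.pi fun i : Fin n => (-1 : ℝ) ^ ((i : ℕ) + 1) • lcoeff ℝ (n - (i + 1))

-- Vieta. As `signedCoeffs` is linear, adding a polynomial to ∏ (X - yᵢ) translates the e-values.
open Polynomial in
theorem esymmValues_eq_signedCoeffs {n : ℕ} (y : Fin n → ℝ) :
    esymmValues y =
      signedCoeffs n ((Finset.univ.val.map y).map fun a => X - C a).prod := by
  funext i
  have hcard : Multiset.card (Finset.univ.val.map y) = n := by simp
  have h1 : esymmValues y i = (Finset.univ.val.map y).esymm ((i : ℕ) + 1) := by
    have := MvPolynomial.aeval_esymm_eq_multiset_esymm (Fin n) ℝ ((i : ℕ) + 1) y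
    rw [← this]
    rfl
  have h2 := Multiset.prod_X_sub_C_coeff (Finset.univ.val.map y) (k := n - (i + 1)) (by omega)
  have h3 : n - (n - ((i : ℕ) + 1)) = i + 1 := by omega
  rw [hcard, h3] at h2
  simp only [signedCoeffs, LinearMap.pi_apply, LinearMap.smul_apply, lcoeff_apply, smul_eq_mul]
  rw [h2, h1, ← mul_assoc, ← mul_pow]
  simp

open Polynomial in
theorem signedCoeffs_ne_zero {n : ℕ} {p : ℝ[X]} (hp : p ≠ 0) (hdeg : p.degree < n) :
    signedCoeffs n p ≠ 0 := by
  intro h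
  apply hp
  ext j
  rcases lt_or_ge j n with hj | hj
  · have h1 := congrFun h ⟨n - (j + 1), by omega⟩
    have h2 : n - (n - (j + 1) + 1) = j := by omega
    simpa [signedCoeffs, h2] using h1
  · exact coeff_eq_zero_of_degree_lt (hdeg.trans_le (by exact_mod_cast hj))

theorem exists_map_univ_eq {n : ℕ} (M : Multiset ℝ) (hM : Multiset.card M = n) :
    ∃ y : Fin n → ℝ, Finset.univ.val.map y = M := by
  subst hM
  induction M using Quotient.inductionOn with
  | h l => exact ⟨l.get, (Fin.univ_val_map l.get).trans (by simp)⟩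

open Polynomial in
/-- A point with more than `k` distinct coordinates can be moved in two opposite directions
inside any fibre given by `k` linear conditions on the elementary symmetric values. -/
theorem exists_opposite_perturbations {n k : ℕ} (L : (Fin n → ℝ) →ₗ[ℝ] (Fin k → ℝ))
    (y : Fin n → ℝ) (hy : k < (Set.range y).ncard) :
    ∃ v : Fin n → ℝ, v ≠ 0 ∧ L v = 0 ∧ (∃ y₁, esymmValues y₁ = esymmValues y + v) ∧
      ∃ y₂, esymmValues y₂ = esymmValues y - v := by
  classical
  set M : Multiset ℝ := Finset.univ.val.map y with hM
  set s : Finset ℝ := M.toFinset with hs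
  have hsk : k < s.card := by
    have : (s : Set ℝ) = Set.range y := by
      ext a
      simp [hs, hM]
    rwa [← this, Set.ncard_coe_finset] at hy
  have hsM : s.val ≤ M := Multiset.dedup_le M
  set N : Multiset ℝ := M - s.val with hN
  have hNM : N + s.val = M := tsub_add_cancel_of_le hsM
  have hcM : Multiset.card M = n := by simp [hM]
  have hcN : Multiset.card N + s.card = n := by
    rw [← hcM, ← hNM, Multiset.card_add]
    rfl
  set Q : ℝ[X] := (N.map fun a => X - C a).prod with hQ
  have hQm : Q.Monic := monic_multiset_prod_of_monic _ _ fun a _ => monic_X_sub_C a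
  have hQd : Q.natDegree = Multiset.card N := natDegree_multiset_prod_X_sub_C_eq_card N
  -- The repeated roots stay in Q; only the simple-rooted factor over `s` is perturbed, by S. The
  -- space of such S has dimension `s.card > k`, so L kills some nonzero direction Q * S.
  let φ : degreeLT ℝ s.card →ₗ[ℝ] (Fin k → ℝ) :=
    L ∘ₗ signedCoeffs n ∘ₗ LinearMap.mulLeft ℝ Q ∘ₗ (degreeLT ℝ s.card).subtype
  have hfin : Module.finrank ℝ (degreeLT ℝ s.card) = s.card := by
    rw [(degreeLTEquiv ℝ s.card).finrank_eq]
    simp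
  have : FiniteDimensional ℝ (degreeLT ℝ s.card) :=
    (degreeLTEquiv ℝ s.card).symm.finiteDimensional
  have hker : LinearMap.ker φ ≠ ⊥ := by
    apply LinearMap.ker_ne_bot_of_finrank_lt
    rw [hfin]
    simpa using hsk
  obtain ⟨⟨S, hSdeg⟩, hSker, hS0⟩ := Submodule.exists_mem_ne_zero_of_ne_bot hker
  have hSne : S ≠ 0 := fun h => hS0 (Subtype.ext h)
  have hLS : L (signedCoeffs n (Q * S)) = 0 := hSker
  rw [mem_degreeLT] at hSdeg
  have hQS : signedCoeffs n (Q * S) ≠ 0 := by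
    apply signedCoeffs_ne_zero (mul_ne_zero hQm.ne_zero hSne)
    rw [← natDegree_lt_iff_degree_lt (mul_ne_zero hQm.ne_zero hSne),
      natDegree_mul hQm.ne_zero hSne, hQd]
    have := (natDegree_lt_iff_degree_lt hSne).2 hSdeg
    omega
  have hmove : ∀ t : ℝ, (∃ b : ℝ → ℝ,
      ∏ a ∈ s, (X - C a) + t • S = ∏ a ∈ s, (X - C (b a))) →
      ∃ y', esymmValues y' = esymmValues y + t • signedCoeffs n (Q * S) := by
    rintro t ⟨b, hb⟩
    obtain ⟨y', hy'⟩ := exists_map_univ_eq (n := n) (N + s.val.map b) (by simpa using hcN)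
    refine ⟨y', ?_⟩
    rw [esymmValues_eq_signedCoeffs, esymmValues_eq_signedCoeffs, hy', ← hM, ← hNM,
      ← map_smul, ← map_add]
    congr 1
    have h1 : ((s.val.map b).map fun a => X - C a).prod = ∏ a ∈ s, (X - C (b a)) := by
      rw [Multiset.map_map]
      rfl
    have h2 : (s.val.map fun a => X - C a).prod = ∏ a ∈ s, (X - C a) := rfl
    rw [Multiset.map_add, Multiset.prod_add, Multiset.map_add, Multiset.prod_add, h1, h2, ← hb,
      mul_add, mul_smul_comm]
  have hev := exists_prod_X_sub_C_add_smul s S hSdeg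
  have hneg : Filter.Tendsto (fun t : ℝ => -t) (nhds 0) (nhds 0) := by
    simpa using (continuous_neg (G := ℝ)).tendsto 0
  obtain ⟨t, ⟨ht1, ht2⟩, ht0⟩ := (((hev.and (hneg.eventually hev)).filter_mono
    nhdsWithin_le_nhds).and (self_mem_nhdsWithin (s := Set.Ioi (0 : ℝ)))).exists
  refine ⟨t • signedCoeffs n (Q * S), smul_ne_zero (ne_of_gt ht0) hQS, ?_, hmove t ht1, ?_⟩
  · rw [map_smul, hLS, smul_zero]
  · obtain ⟨y', hy'⟩ := hmove (-t) ht2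
    exact ⟨y', by rw [hy', neg_smul, sub_eq_add_neg]⟩

/-- Newton's identity for the second power sum. -/
theorem sum_sq_eq_esymmValues {n : ℕ} (hn : 2 ≤ n) (y : Fin n → ℝ) :
    ∑ i, y i ^ 2 = esymmValues y ⟨0, by omega⟩ ^ 2 - 2 * esymmValues y ⟨1, by omega⟩ := by
  have h := congrArg (MvPolynomial.eval y) (MvPolynomial.mul_esymm_eq_sum (Fin n) ℝ 2)
  have hf : (Finset.HasAntidiagonal.antidiagonal 2).filter (fun a : ℕ × ℕ => a.1 < 2) = {(0, 2), (1, 1)} := by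
    decide
  rw [hf, Finset.sum_pair (by decide)] at h
  have h1 : esymmValues y ⟨0, by omega⟩ = ∑ i, y i := by
    simp [esymmValues, MvPolynomial.esymm_one]
  have h2 : MvPolynomial.eval y (MvPolynomial.esymm (Fin n) ℝ 2) =
    esymmValues y ⟨1, by omega⟩ := rfl
  simp only [map_mul, map_add, map_pow, map_neg, map_one, h2, MvPolynomial.psum,
    MvPolynomial.esymm_one, MvPolynomial.esymm_zero, map_sum, MvPolynomial.eval_X, pow_one,
    pow_zero, Nat.cast_ofNat, map_ofNat] at h
  rw [h1]
  linear_combination h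

/-- If `k` linear conditions on `(e₁, …, eₙ)` determine `e₁`, then every point can be replaced by
one with at most `k` distinct coordinates satisfying the same conditions. -/
theorem exists_fewCoords_of_ker {n k : ℕ} (hk : 1 ≤ k) (hn : 0 < n)
    (L : (Fin n → ℝ) →ₗ[ℝ] (Fin k → ℝ)) (hL : ∀ v, L v = 0 → v ⟨0, hn⟩ = 0)
    (x : Fin n → ℝ) : ∃ y ∈ fewCoords n k, L (esymmValues y) = L (esymmValues x) := by
  have hLc : Continuous fun y : Fin n → ℝ => L (esymmValues y) :=
    L.continuous_of_finiteDimensional.comp continuous_esymmValues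
  have hqc : Continuous fun y : Fin n → ℝ => ∑ i, y i ^ 2 := by fun_prop
  have hcompact : ∀ r : ℝ, IsCompact
      {y : Fin n → ℝ | L (esymmValues y) = L (esymmValues x) ∧ ∑ i, y i ^ 2 ≤ r} := by
    intro r
    refine (isCompact_univ_pi fun _ : Fin n => isCompact_Icc
      (a := -(1 + r)) (b := 1 + r)).of_isClosed_subset ((isClosed_eq hLc continuous_const).inter
        (isClosed_le hqc continuous_const)) ?_
    rintro y ⟨-, hy⟩ i -
    have h : y i ^ 2 ≤ r :=
      (Finset.single_le_sum (fun j _ => sq_nonneg (y j)) (Finset.mem_univ i)).trans hy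
    constructor <;> nlinarith [sq_nonneg (y i - 1), sq_nonneg (y i + 1), sq_nonneg (y i)]
  obtain ⟨w, ⟨hwL, -⟩, hwmin⟩ := (hcompact (∑ i, x i ^ 2)).exists_isMinOn ⟨x, rfl, le_rfl⟩
    hqc.continuousOn
  have hmin : ∀ y, L (esymmValues y) = L (esymmValues x) → ∑ i, w i ^ 2 ≤ ∑ i, y i ^ 2 := by
    intro y hy
    rcases le_total (∑ i, y i ^ 2) (∑ i, x i ^ 2) with h | h
    · exact hwmin ⟨hy, h⟩
    · exact (hwmin ⟨rfl, le_rfl⟩ : ∑ i, w i ^ 2 ≤ ∑ i, x i ^ 2).trans h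
  -- Minimality alone is not enough: it does not exclude directions v that leave e₂ unchanged.
  have hsc : Continuous fun y : Fin n → ℝ => ∑ i, esymmValues y i ^ 2 :=
    continuous_finsetSum _ fun i _ => ((continuous_apply i).comp continuous_esymmValues).pow 2
  obtain ⟨y, ⟨hyL, hyw⟩, hymax⟩ := (hcompact (∑ i, w i ^ 2)).exists_isMaxOn ⟨w, hwL, le_rfl⟩
    hsc.continuousOn
  refine ⟨y, ?_, hyL⟩
  by_contra hfew
  have hcard : k < (Set.range y).ncard := not_le.1 hfew
  have hn2 : 2 ≤ n := by
    have h := Set.ncard_image_le (f := y) (Set.finite_univ (α := Fin n))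
    rw [Set.image_univ, Set.ncard_univ, Nat.card_fin] at h
    omega
  obtain ⟨v, hv0, hLv, ⟨y₁, hy₁⟩, y₂, hy₂⟩ := exists_opposite_perturbations L y hcard
  have hL₁ : L (esymmValues y₁) = L (esymmValues x) := by rw [hy₁, map_add, hLv, add_zero, hyL]
  have hL₂ : L (esymmValues y₂) = L (esymmValues x) := by rw [hy₂, map_sub, hLv, sub_zero, hyL]
  have hv : v ⟨0, hn⟩ = 0 := hL v hLv
  have hq := sum_sq_eq_esymmValues hn2 y
  have hq₁ := sum_sq_eq_esymmValues hn2 y₁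
  have hq₂ := sum_sq_eq_esymmValues hn2 y₂
  simp only [hy₁, hy₂, Pi.add_apply, Pi.sub_apply, hv, add_zero, sub_zero] at hq₁ hq₂
  have hm₁ := hmin y₁ hL₁
  have hm₂ := hmin y₂ hL₂
  -- The square sums of y₁ and y₂ average to the minimum, so both points are minimisers too.
  have hs₁ : ∑ i, esymmValues y₁ i ^ 2 ≤ ∑ i, esymmValues y i ^ 2 :=
    hymax ⟨hL₁, by linarith⟩
  have hs₂ : ∑ i, esymmValues y₂ i ^ 2 ≤ ∑ i, esymmValues y i ^ 2 :=
    hymax ⟨hL₂, by linarith⟩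
  have hsum : ∑ i, esymmValues y₁ i ^ 2 + ∑ i, esymmValues y₂ i ^ 2 =
      2 * ∑ i, esymmValues y i ^ 2 + 2 * ∑ i, v i ^ 2 := by
    rw [Finset.mul_sum, Finset.mul_sum, ← Finset.sum_add_distrib, ← Finset.sum_add_distrib]
    refine Finset.sum_congr rfl fun i _ => ?_
    rw [hy₁, hy₂, Pi.add_apply, Pi.sub_apply]
    ring
  obtain ⟨i, hi⟩ := Function.ne_iff.1 hv0
  have hpos : 0 < ∑ i, v i ^ 2 :=
    Finset.sum_pos' (fun j _ => sq_nonneg (v j)) ⟨i, Finset.mem_univ i, sq_pos_of_ne_zero hi⟩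
  linarith

/-! ### From fibres of linear conditions to values of f. -/

theorem isValueComplete_iff {n m : ℕ} {f : MvPolynomial (Fin n) ℝ} :
    IsValueComplete m f ↔
      ∀ x, ∃ y ∈ fewCoords n m, MvPolynomial.eval y f = MvPolynomial.eval x f := by
  constructor
  · intro h x
    have hx : MvPolynomial.eval x f ∈ (fun x => MvPolynomial.eval x f) '' fewCoords n m :=
      h ▸ ⟨x, Set.mem_univ x, rfl⟩
    exact hx
  · intro h
    refine Set.Subset.antisymm ?_ (Set.image_mono (Set.subset_univ _))
    rintro _ ⟨x, -, rfl⟩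
    exact h x

/-- The linear function on `ℝⁿ` with the coefficients of the degree-one part of a polynomial. -/
noncomputable def linearPart {n : ℕ} (p : MvPolynomial (Fin n) ℝ) : (Fin n → ℝ) →ₗ[ℝ] ℝ :=
  ∑ i, p.coeff (Finsupp.single i 1) • LinearMap.proj i

theorem eval_eq_linearPart {n : ℕ} {p : MvPolynomial (Fin n) ℝ} (hp : p.IsHomogeneous 1)
    (v : Fin n → ℝ) : MvPolynomial.eval v p = linearPart p v := by
  have hmem : p ∈
      Submodule.span ℝ (Set.range (MvPolynomial.X : Fin n → MvPolynomial (Fin n) ℝ)) := by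
    rw [← MvPolynomial.homogeneousSubmodule_one_eq_span_X]
    exact hp
  clear hp
  induction hmem using Submodule.span_induction with
  | mem q hq =>
    obtain ⟨j, rfl⟩ := hq
    simp [linearPart, MvPolynomial.coeff_X, Finsupp.single_left_inj]
  | zero => simp [linearPart]
  | add q r _ _ hq hr =>
    simp [linearPart, hq, hr, add_mul, Finset.sum_add_distrib]
  | smul c q _ hq =>
    simp [linearPart, hq, mul_assoc, Finset.mul_sum]

theorem eval_eq_of_isSufficient {n k : ℕ} {l : Fin k → MvPolynomial (Fin n) ℝ}
    {f : MvPolynomial (Fin n) ℝ} (hf : IsSufficient l f) {x y : Fin n → ℝ}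
    (h : ∀ j, MvPolynomial.eval (esymmValues y) (l j) = MvPolynomial.eval (esymmValues x) (l j)) :
    MvPolynomial.eval y f = MvPolynomial.eval x f := by
  obtain ⟨g, hg, rfl⟩ := hf
  have key : ∀ z : Fin n → ℝ, MvPolynomial.eval z (MvPolynomial.aeval
      (fun i : Fin n => MvPolynomial.esymm (Fin n) ℝ ((i : ℕ) + 1)) g) =
      MvPolynomial.aeval (esymmValues z) g := by
    intro z
    have := MvPolynomial.comp_aeval_apply
      (fun i : Fin n => MvPolynomial.esymm (Fin n) ℝ ((i : ℕ) + 1))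
      (MvPolynomial.aeval z : MvPolynomial (Fin n) ℝ →ₐ[ℝ] ℝ) g
    exact this
  rw [key, key]
  have hle : Algebra.adjoin ℝ (Set.range l) ≤ AlgHom.equalizer
      (MvPolynomial.aeval (esymmValues y)) (MvPolynomial.aeval (R := ℝ) (esymmValues x)) := by
    rw [Algebra.adjoin_le_iff]
    rintro _ ⟨j, rfl⟩
    exact h j
  exact hle hg

end HyperbolicSlices

open HyperbolicSlices in
theorem corollary3p9 (n k : ℕ) (hk : 1 ≤ k) (hkn : k ≤ n)
    (l : Fin k → MvPolynomial (Fin n) ℝ)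
    (hl : ∀ j, (l j).IsHomogeneous 1) (hli : LinearIndependent ℝ l)
    (f : MvPolynomial (Fin n) ℝ) (hf : f.IsSymmetric)
    (hsuff : HyperbolicSlices.IsSufficient l f) :
    HyperbolicSlices.IsValueComplete (k + 1) f ∧
      ((MvPolynomial.X (⟨0, Nat.lt_of_lt_of_le hk hkn⟩ : Fin n) : MvPolynomial (Fin n) ℝ) ∈
          Submodule.span ℝ (Set.range l) →
        HyperbolicSlices.IsValueComplete k f) := by
  have hn : 0 < n := Nat.lt_of_lt_of_le hk hkn
  refine ⟨isValueComplete_iff.2 fun x => ?_, fun hX => isValueComplete_iff.2 fun x => ?_⟩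
  · obtain ⟨y, hy, hyL⟩ := exists_fewCoords_of_ker (k := k + 1) (by omega) hn
      (LinearMap.pi (Fin.cons (LinearMap.proj ⟨0, hn⟩) fun j => linearPart (l j)))
      (fun v hv => by simpa using congrFun hv 0) x
    refine ⟨y, hy, eval_eq_of_isSufficient hsuff fun j => ?_⟩
    rw [eval_eq_linearPart (hl j), eval_eq_linearPart (hl j)]
    simpa using congrFun hyL j.succ
  · obtain ⟨y, hy, hyL⟩ := exists_fewCoords_of_ker hk hn
      (LinearMap.pi fun j => linearPart (l j)) (fun v hv => by
        -- Evaluation at v vanishes on every l j, hence on their span, which contains Z₁.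
        have hle : Submodule.span ℝ (Set.range l) ≤
            LinearMap.ker (MvPolynomial.aeval v : MvPolynomial (Fin n) ℝ →ₐ[ℝ] ℝ).toLinearMap := by
          rw [Submodule.span_le]
          rintro _ ⟨j, rfl⟩
          exact (eval_eq_linearPart (hl j) v).trans (congrFun hv j)
        have h0 := hle hX
        simpa using h0) x
    refine ⟨y, hy, eval_eq_of_isSufficient hsuff fun j => ?_⟩
    rw [eval_eq_linearPart (hl j), eval_eq_linearPart (hl j)]
    exact congrFun hyL j
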